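/- **Setting.** Let $\lambda\in(0,1)$, $0\le x_0<\lambda$, and let $f_L,f_R:\mathbb R\to(0,1)$ be $C^2$ and $2$-periodic. The billiard table is the unit square $[0,1]^2$ with two horizontal slits that move vertically: at time $t$ the left slit is $[0,\lambda]\times\{f_L(t)\}$ and the right slit is $[\lambda,1]\times\{f_R(t)\}$. A point ball moves freely and is reflected elastically by the sides of the square and by the moving slits. Its horizontal speed is $1$: its horizontal coordinate $x(t)$ is the $2$-periodic function with $x(t)=x_0+t$ for $0\le x_0+t\le 1$ and $x(t)=2-x_0-t$ for $1\le x_0+t\le 2$. In each period the ball passes from the left part to the right part of the table at time $t_1^*=\lambda-x_0$ and from the right part to the left part at time $t_2^*=2-\lambda-x_0$ (modulo $2$). A *forward orbit*, started at any time $t_0\in\mathbb R$, is given by the height $y(t)\in[0,1]$ and the vertical velocity $v(t)$ of the ball for all $t\ge t_0$, where $v(t)$ is the velocity just after the collision if a collision occurs at time $t$. There are only finitely many collisions in bounded time. Between collisions with the floor $y=0$, the ceiling $y=1$ and the slit on the side of the ball, $v$ is constant and $y$ moves with velocity $v$. At a collision with the floor or the ceiling $v$ is replaced by $-v$, and at a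 collision with a slit of height $f\in\{f_L,f_R\}$ it is replaced by $2\dot f(t)-v$. The ball never crosses a slit, and orbits that hit a slit at the horizontal coordinate $x=\lambda$ are excluded. The *lower chamber is trapping* if $f_L(t_1^*)<f_R(t_1^*)$ and $f_L(t_2^*)>f_R(t_2^*)$. The *upper chamber is trapping* if $f_L(t_1^*)>f_R(t_1^*)$ and $f_L(t_2^*)<f_R(t_2^*)$. A forward orbit is *oscillatory* if $$\limsup_{t\to+\infty}|v(t)|=\infty\quad\text{and}\quad\liminf_{t\to+\infty}|v(t)|<\infty .$$ **Statement.** If the lower or the upper chamber is trapping, then there is no oscillatory forward orbit. -/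

import Mathlib

open Filter Topology Set

noncomputable section

/-- The data of the billiard: the table is the unit square, the left slit has length `lam` and
height `fL t` at time `t`, the right slit has length `1 - lam` and height `fR t`. The slits move
inside the open square, and their heights are `C²` and `2`-periodic functions of time.
At time `0` the ball has horizontal coordinate `x₀` over the left part and moves to the right. -/
structure SlitBilliard where
  lam : ℝ
  x₀ : ℝ
  fL : ℝ → ℝ
  fR : ℝ → ℝ
  lam_pos : 0 < lam
  lam_lt_one : lam < 1
  x₀_nonneg : 0 ≤ x₀
  x₀_lt_lam : x₀ < lam
  fL_contDiff : ContDiff ℝ 2 fL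
  fR_contDiff : ContDiff ℝ 2 fR
  fL_periodic : Function.Periodic fL 2
  fR_periodic : Function.Periodic fR 2
  fL_mem : ∀ t, fL t ∈ Ioo (0 : ℝ) 1
  fR_mem : ∀ t, fR t ∈ Ioo (0 : ℝ) 1

namespace SlitBilliard

variable (B : SlitBilliard)

/-- Horizontal coordinate of the ball at time `t`: unit speed with elastic reflection at the sides
`0` and `1`. This is `s` for `s ∈ [0, 1]` and `2 - s` for `s ∈ [1, 2]`, extended `2`-periodically,
where `s = x₀ + t`. -/
def horizontalPos (t : ℝ) : ℝ := 1 - |1 - 2 * Int.fract ((B.x₀ + t) / 2)|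

/-- First critical time: the ball jumps from the left slit to the right one. -/
def tStar₁ : ℝ := B.lam - B.x₀

/-- Second critical time: the ball jumps from the right slit to the left one. -/
def tStar₂ : ℝ := 2 - B.lam - B.x₀

/-- Height at time `t` of the slit that is in the vertical line of the ball. (At the instants when
the ball is at `lam`, contact with either slit is excluded for orbits.) -/
def slitHeight (t : ℝ) : ℝ := if B.horizontalPos t < B.lam then B.fL t else B.fR t

/-- Vertical velocity at time `t` of the slit that is in the vertical line of the ball. -/
def slitVelocity (t : ℝ) : ℝ := if B.horizontalPos t < B.lam then deriv B.fL t else deriv B.fR t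

/-- The lower chamber is trapping: at each of the two jumps the next slit is above the
previous one. -/
def LowerTrapping : Prop :=
  B.fL B.tStar₁ < B.fR B.tStar₁ ∧ B.fR B.tStar₂ < B.fL B.tStar₂

/-- The upper chamber is trapping: at each of the two jumps the next slit is below the
previous one. -/
def UpperTrapping : Prop :=
  B.fR B.tStar₁ < B.fL B.tStar₁ ∧ B.fL B.tStar₂ < B.fR B.tStar₂

/-- A trapping chamber exists. -/
def HasTrappingChamber : Prop := B.LowerTrapping ∨ B.UpperTrapping

/-- The ball at height `y t` touches the floor, the ceiling or the slit at time `t`. -/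
def IsContact (y : ℝ → ℝ) (t : ℝ) : Prop := y t = 0 ∨ y t = 1 ∨ y t = B.slitHeight t

/-- `y` (height) and `v` (vertical velocity, with the value just after the collision at collision
times) describe a forward orbit on `[t₀, ∞)`. -/
structure IsForwardOrbit (t₀ : ℝ) (y v : ℝ → ℝ) : Prop where
  /-- The ball stays in the table. -/
  mem_table : ∀ t, t₀ ≤ t → y t ∈ Icc (0 : ℝ) 1
  /-- There is no collision with a slit at the horizontal coordinate `lam`. -/
  avoids_tips : ∀ t, t₀ ≤ t → B.horizontalPos t = B.lam → y t ≠ B.fL t ∧ y t ≠ B.fR t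
  /-- There are finitely many collisions in bounded time. -/
  finite_contacts : ∀ T, {t | t ∈ Icc t₀ T ∧ B.IsContact y t}.Finite
  /-- Between collisions the ball moves freely. -/
  free_flight : ∀ a b, t₀ ≤ a → a < b → (∀ s ∈ Ioo a b, ¬ B.IsContact y s) →
    (∀ s ∈ Ico a b, v s = v a) ∧ ∀ s ∈ Icc a b, y s = y a + v a * (s - a)
  /-- Elastic collision with the floor or the ceiling. -/
  reflect_wall : ∀ t, t₀ < t → (y t = 0 ∨ y t = 1) → ∀ᶠ s in 𝓝[<] t, v t = - v s
  /-- Elastic collision with the moving slit. -/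
  reflect_slit : ∀ t, t₀ < t → y t = B.slitHeight t →
    ∀ᶠ s in 𝓝[<] t, v t = 2 * B.slitVelocity t - v s
  /-- The ball does not cross a slit, not even at a collision with zero relative velocity. -/
  one_side : ∀ a b, t₀ ≤ a → a ≤ b → (∀ s ∈ Icc a b, B.horizontalPos s ≠ B.lam) →
    (∀ s ∈ Icc a b, y s ≤ B.slitHeight s) ∨ (∀ s ∈ Icc a b, B.slitHeight s ≤ y s)

end SlitBilliard

/-- `limsup |v(t)| = ∞` and `liminf |v(t)| < ∞` as `t → +∞`, in the extended reals. -/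
def IsOscillatory (v : ℝ → ℝ) : Prop :=
  limsup (fun t => ((|v t| : ℝ) : EReal)) atTop = ⊤ ∧
    liminf (fun t => ((|v t| : ℝ) : EReal)) atTop < ⊤

end

/-!
While the ball stays in one chamber on one side of the table, it bounces between a fixed wall at
height `c` (`c = 0` for the floor, `c = 1` for the ceiling) and a slit of height `f t`. The quantity
`I = v (f - c) - (y - c) f'` changes sign at every collision with either wall, and in free flight it
has derivative `-(y - c) f''`, which is bounded. Hence `|I|`, and with it `|v| |f - c|`, changes only
by a bounded amount during a passage along one slit, whatever the number of collisions
(`Confined.abs_mul_sub_le`).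

At a crossing of the vertical line of the tips the velocity is unchanged, but the width of the
chamber jumps from `|fL - c|` to `|fR - c|` or conversely. If the ball remains in the same chamber
for all later times, the speeds `u n` at successive crossings to the right therefore satisfy
`u (n + 1) = ρ * u n + O(1)`, where `ρ` is the product of the two ratios of widths. In the presence
of a trapping chamber, the trapping chamber gets wider at both crossings, so that `ρ > 1`, and the
other one gets narrower at both, so that `ρ < 1`. In the second case the speed is bounded. In the
first case it is either bounded or tends to infinity
(`IsForwardOrbit.bounded_or_tendsto_of_confined`).

Finally, a ball that has entered the trapping chamber cannot leave it, so that eventually the ball is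
always in the trapping chamber or always in the other one (`eventually_side`). In all cases the
speed is bounded or tends to infinity, which contradicts oscillation.
-/

namespace SlitBilliard

variable {B : SlitBilliard}

/-! ### Local structure of forward orbits -/

namespace IsForwardOrbit

variable {t₀ : ℝ} {y v : ℝ → ℝ}

theorem exists_isolated (h : B.IsForwardOrbit t₀ y v) (t : ℝ) :
    ∃ ε > 0, ∀ s, t₀ ≤ s → |s - t| < ε → s ≠ t → ¬ B.IsContact y s := by
  have hfin := (h.finite_contacts (t + 1)).sdiff (t := {t})
  have hmem := hfin.isClosed.isOpen_compl.mem_nhds (x := t) (by simp)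
  obtain ⟨ε, hε, hball⟩ := Metric.mem_nhds_iff.1 hmem
  refine ⟨min ε 1, lt_min hε one_pos, fun s hs hst hne hc => ?_⟩
  have hs1 : |s - t| < ε := hst.trans_le (min_le_left _ _)
  have hs2 : |s - t| < 1 := hst.trans_le (min_le_right _ _)
  have := hball (show s ∈ Metric.ball t ε by rwa [Metric.mem_ball, Real.dist_eq])
  exact this ⟨⟨⟨hs, by linarith [(abs_lt.1 hs2).2]⟩, hc⟩, hne⟩

theorem exists_flight_right (h : B.IsForwardOrbit t₀ y v) {t : ℝ} (ht : t₀ ≤ t) :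
    ∃ b > t, (∀ s ∈ Ico t b, v s = v t) ∧ ∀ s ∈ Icc t b, y s = y t + v t * (s - t) := by
  obtain ⟨ε, hε, hiso⟩ := h.exists_isolated t
  refine ⟨t + ε, by linarith, h.free_flight t (t + ε) ht (by linarith) fun s hs => ?_⟩
  refine hiso s (ht.trans hs.1.le) ?_ hs.1.ne'
  rw [abs_lt]
  constructor <;> linarith [hs.1, hs.2]

/-- Just before a time `t` the ball flies freely, and it keeps its velocity at `t` unless there is
a contact. -/
theorem exists_flight_left (h : B.IsForwardOrbit t₀ y v) {t : ℝ} (ht : t₀ < t) :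
    ∃ a, t₀ ≤ a ∧ a < t ∧ (∀ s ∈ Ico a t, v s = v a) ∧
      (∀ s ∈ Icc a t, y s = y a + v a * (s - a)) ∧ (¬ B.IsContact y t → v t = v a) := by
  obtain ⟨ε, hε, hiso⟩ := h.exists_isolated t
  have ha1 : t₀ ≤ max t₀ (t - ε) := le_max_left _ _
  have ha2 : t - ε ≤ max t₀ (t - ε) := le_max_right _ _
  have ha3 : max t₀ (t - ε) < t := max_lt ht (by linarith)
  obtain ⟨hv, hy⟩ := h.free_flight (max t₀ (t - ε)) t ha1 ha3 fun s hs =>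
    hiso s (ha1.trans hs.1.le) (by rw [abs_lt]; constructor <;> linarith [hs.1, hs.2]) hs.2.ne
  refine ⟨max t₀ (t - ε), ha1, ha3, hv, hy, fun hc => ?_⟩
  refine (h.free_flight (max t₀ (t - ε)) (t + ε) ha1 (by linarith) fun s hs => ?_).1 t
    ⟨ha3.le, by linarith⟩
  rcases eq_or_ne s t with rfl | hne
  · exact hc
  · exact hiso s (ha1.trans hs.1.le)
      (by rw [abs_lt]; constructor <;> linarith [hs.1, hs.2]) hne

theorem continuousWithinAt_Ici (h : B.IsForwardOrbit t₀ y v) {t : ℝ} (ht : t₀ ≤ t) :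
    ContinuousWithinAt y (Ici t) t ∧ ContinuousWithinAt v (Ici t) t := by
  obtain ⟨b, hb, hv, hy⟩ := h.exists_flight_right ht
  have hmem : Ico t b ∈ 𝓝[≥] t := Ico_mem_nhdsGE hb
  constructor
  · have : ContinuousWithinAt (fun s => y t + v t * (s - t)) (Ici t) t := by fun_prop
    refine this.congr_of_eventuallyEq ?_ (by simp)
    filter_upwards [hmem] with s hs using hy s ⟨hs.1, hs.2.le⟩
  · refine continuousWithinAt_const.congr_of_eventuallyEq (f := fun _ => v t) ?_ rfl
    filter_upwards [hmem] with s hs using hv s hs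

theorem continuousOn (h : B.IsForwardOrbit t₀ y v) : ContinuousOn y (Ici t₀) := by
  intro t ht
  rcases (mem_Ici.1 ht).eq_or_lt with rfl | hlt
  · exact (h.continuousWithinAt_Ici le_rfl).1
  · refine (continuousAt_iff_continuous_left_right.2
      ⟨?_, (h.continuousWithinAt_Ici hlt.le).1⟩).continuousWithinAt
    obtain ⟨a, -, hat, -, hy, -⟩ := h.exists_flight_left hlt
    have : ContinuousWithinAt (fun s => y a + v a * (s - a)) (Iic t) t := by fun_prop
    refine this.congr_of_eventuallyEq ?_ (hy t ⟨hat.le, le_rfl⟩)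
    filter_upwards [Ioc_mem_nhdsLE hat] with s hs using hy s ⟨hs.1.le, hs.2⟩

end IsForwardOrbit

/-! ### The adiabatic invariant -/

/-- The adiabatic quantity of a ball between a fixed wall at height `c` and a wall at height `f t`:
the momentum conjugate to the rescaled height `(y - c) / (f - c)`. -/
noncomputable def adiabatic (f : ℝ → ℝ) (c : ℝ) (y v : ℝ → ℝ) (t : ℝ) : ℝ :=
  v t * (f t - c) - (y t - c) * deriv f t

variable (B) in
/-- During `(a, b]` the ball collides only with the fixed wall at height `c` and with a slit whose
height is given by `f`. -/
noncomputable def Confined (f : ℝ → ℝ) (c : ℝ) (y : ℝ → ℝ) (a b : ℝ) : Prop :=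
  ∀ t ∈ Ioc a b, B.IsContact y t → ((y t = 0 ∨ y t = 1) ∧ y t = c) ∨
    (y t = B.slitHeight t ∧ B.slitHeight t = f t ∧ B.slitVelocity t = deriv f t)

section Adiabatic

variable {t₀ : ℝ} {y v f : ℝ → ℝ} {a b c M : ℝ}

/-- A collision changes the sign of the adiabatic quantity, so its absolute value is continuous. -/
theorem Confined.continuousOn_abs_adiabatic (hf : ContDiff ℝ 2 f) (h : B.IsForwardOrbit t₀ y v)
    (ha : t₀ ≤ a) (hc : B.Confined f c y a b) :
    ContinuousOn (fun t => |adiabatic f c y v t|) (Icc a b) := by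
  have hfc : Continuous f := hf.continuous
  have hfc' : Continuous (deriv f) := hf.continuous_deriv (by norm_num)
  have hright : ∀ t, t₀ ≤ t → ContinuousWithinAt (fun t => |adiabatic f c y v t|) (Ici t) t := by
    intro t ht
    obtain ⟨hy, hv⟩ := h.continuousWithinAt_Ici ht
    exact ((hv.mul (hfc.continuousWithinAt.sub continuousWithinAt_const)).sub
      ((hy.sub continuousWithinAt_const).mul hfc'.continuousWithinAt)).abs
  intro t ht
  rcases ht.1.eq_or_lt with rfl | hat
  · exact (hright a ha).mono Icc_subset_Ici_self
  have ht0 : t₀ < t := ha.trans_lt hat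
  refine (continuousAt_iff_continuous_left_right.2 ⟨?_, hright t ht0.le⟩).continuousWithinAt
  obtain ⟨a', ha', hat', hv, hy, hnc⟩ := h.exists_flight_left ht0
  have hyt : ContinuousWithinAt y (Iio t) t :=
    ((h.continuousOn.continuousAt (Ici_mem_nhds ht0))).continuousWithinAt
  -- the value at `t` agrees up to sign with the one for the incoming velocity
  have key : |adiabatic f c y v t| = |v a' * (f t - c) - (y t - c) * deriv f t| := by
    unfold adiabatic
    have hev : ∀ᶠ s in 𝓝[<] t, v s = v a' := by
      filter_upwards [Ico_mem_nhdsLT hat'] with s hs using hv s hs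
    by_cases hcon : B.IsContact y t
    · rcases hc t ⟨hat, ht.2⟩ hcon with ⟨hw, hyc⟩ | ⟨hs, hs1, hs2⟩
      · obtain ⟨s, hs1, hs2⟩ := ((h.reflect_wall t ht0 hw).and hev).exists
        rw [hs1, hs2, hyc, ← abs_neg]
        ring_nf
      · obtain ⟨s, hs3, hs4⟩ := ((h.reflect_slit t ht0 hs).and hev).exists
        rw [hs3, hs4, hs, hs1, hs2, ← abs_neg]
        ring_nf
    · rw [hnc hcon]
  rw [← continuousWithinAt_Iio_iff_Iic]
  have hlim : Tendsto (fun s => |v a' * (f s - c) - (y s - c) * deriv f s|) (𝓝[<] t)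
      (𝓝 |v a' * (f t - c) - (y t - c) * deriv f t|) :=
    ((continuousWithinAt_const.mul (hfc.continuousWithinAt.sub continuousWithinAt_const)).sub
      ((hyt.sub continuousWithinAt_const).mul hfc'.continuousWithinAt)).abs
  rw [ContinuousWithinAt, key]
  refine hlim.congr' ?_
  filter_upwards [Ico_mem_nhdsLT hat'] with s hs
  rw [adiabatic, hv s hs]

/-- In free flight the adiabatic quantity has derivative `-(y - c) f''`. -/
theorem abs_adiabatic_sub_le_of_flight (hf : ContDiff ℝ 2 f) {t : ℝ} (htb : t ≤ b)
    (hM : ∀ s, |deriv (deriv f) s| ≤ M) (hv : ∀ s ∈ Icc t b, v s = v t)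
    (hy : ∀ s ∈ Icc t b, y s = y t + v t * (s - t)) (hyc : ∀ s ∈ Icc t b, |y s - c| ≤ 1) :
    |adiabatic f c y v b - adiabatic f c y v t| ≤ M * (b - t) := by
  set g : ℝ → ℝ := fun s => v t * (f s - c) - (y t + v t * (s - t) - c) * deriv f s
  have hg : ∀ s ∈ Icc t b, adiabatic f c y v s = g s := fun s hs => by
    simp only [adiabatic, hv s hs, hy s hs, g]
  have hdf : Differentiable ℝ f := hf.differentiable (by norm_num)
  have hdf' : Differentiable ℝ (deriv f) :=
    (contDiff_succ_iff_deriv (n := 1).1 hf).2.2.differentiable (by norm_num)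
  have hder : ∀ s ∈ Icc t b, HasDerivWithinAt g (-(y s - c) * deriv (deriv f) s) (Icc t b) s := by
    intro s hs
    have h1 := ((hdf s).hasDerivAt.sub_const c).const_mul (v t)
    have h2 := ((((hasDerivAt_id s).sub_const t).const_mul (v t)).const_add (y t)).sub_const c
    have h3 := h1.sub (h2.mul (hdf' s).hasDerivAt)
    refine (h3.congr_deriv ?_).hasDerivWithinAt
    rw [hy s hs]
    simp only [id]
    ring
  have hbound : ∀ s ∈ Icc t b, ‖-(y s - c) * deriv (deriv f) s‖ ≤ M := by
    intro s hs
    rw [Real.norm_eq_abs, abs_mul, abs_neg]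
    calc |y s - c| * |deriv (deriv f) s| ≤ 1 * M :=
          mul_le_mul (hyc s hs) (hM s) (abs_nonneg _) zero_le_one
      _ = M := one_mul M
  have := (convex_Icc t b).norm_image_sub_le_of_norm_hasDerivWithin_le hder hbound
    (left_mem_Icc.2 htb) (right_mem_Icc.2 htb)
  rw [hg b (right_mem_Icc.2 htb), hg t (left_mem_Icc.2 htb)]
  rwa [Real.norm_eq_abs, Real.norm_eq_abs, abs_of_nonneg (sub_nonneg.2 htb)] at this

theorem Confined.abs_abs_adiabatic_sub_le (hf : ContDiff ℝ 2 f) (h : B.IsForwardOrbit t₀ y v)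
    (ha : t₀ ≤ a) (hc : B.Confined f c y a b) (hc01 : c = 0 ∨ c = 1)
    (hM : ∀ s, |deriv (deriv f) s| ≤ M) :
    ∀ s ∈ Icc a b, |(|adiabatic f c y v s| - |adiabatic f c y v a|)| ≤ M * (s - a) := by
  have hcont := hc.continuousOn_abs_adiabatic hf h ha
  have hyc : ∀ s, t₀ ≤ s → |y s - c| ≤ 1 := fun s hs => by
    have := h.mem_table s hs
    rw [abs_le]
    rcases hc01 with rfl | rfl <;> constructor <;> linarith [this.1, this.2]
  set S : Set ℝ := {s | |(|adiabatic f c y v s| - |adiabatic f c y v a|)| ≤ M * (s - a)}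
  have hclosed : IsClosed (S ∩ Icc a b) := by
    have := (hcont.sub (continuousOn_const (c := |adiabatic f c y v a|))).abs
    have h2 : ContinuousOn (fun s => M * (s - a)) (Icc a b) := by fun_prop
    have h3 := isClosed_Icc.isClosed_le this h2
    convert h3 using 1
    ext s
    simp only [S, mem_inter_iff, mem_ofPred_eq]
    exact and_comm
  refine hclosed.Icc_subset_of_forall_mem_nhdsWithin (by simp [S]) ?_
  intro t ⟨htS, ht⟩
  obtain ⟨d, htd, hv, hy⟩ := h.exists_flight_right (ha.trans ht.1)
  filter_upwards [Ioo_mem_nhdsGT htd] with s hs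
  have h1 := abs_adiabatic_sub_le_of_flight (f := f) (c := c) (b := s) hf hs.1.le hM
    (fun r hr => hv r ⟨hr.1, hr.2.trans_lt hs.2⟩) (fun r hr => hy r ⟨hr.1, hr.2.trans hs.2.le⟩)
    (fun r hr => hyc r ((ha.trans ht.1).trans hr.1))
  have h2 := abs_abs_sub_abs_le_abs_sub (adiabatic f c y v s) (adiabatic f c y v t)
  have h3 := abs_sub_le |adiabatic f c y v s| |adiabatic f c y v t| |adiabatic f c y v a|
  have h4 : |(|adiabatic f c y v t| - |adiabatic f c y v a|)| ≤ M * (t - a) := htS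
  have h5 : |(|adiabatic f c y v s| - |adiabatic f c y v a|)| ≤ M * (s - a) := by linarith
  exact h5

/-- Adiabatic invariance of `|v| |f - c|`, up to a bounded error, while the ball is confined. -/
theorem Confined.abs_mul_sub_le (hf : ContDiff ℝ 2 f) (h : B.IsForwardOrbit t₀ y v)
    (ha : t₀ ≤ a) (hc : B.Confined f c y a b) (hc01 : c = 0 ∨ c = 1) (hba : b - a ≤ 2)
    (hM : ∀ s, |deriv (deriv f) s| ≤ M) {M' : ℝ} (hM' : ∀ s, |deriv f s| ≤ M') :
    ∀ s ∈ Icc a b, |(|v s| * |f s - c| - |v a| * |f a - c|)| ≤ 2 * M + 2 * M' := by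
  intro s hs
  have hcmp : ∀ r, t₀ ≤ r → |(|adiabatic f c y v r| - |v r| * |f r - c|)| ≤ M' := by
    intro r hr
    have hyc : |y r - c| ≤ 1 := by
      have := h.mem_table r hr
      rw [abs_le]
      rcases hc01 with rfl | rfl <;> constructor <;> linarith [this.1, this.2]
    rw [← abs_mul]
    refine (abs_abs_sub_abs_le_abs_sub _ _).trans ?_
    rw [adiabatic, sub_sub_cancel_left, abs_neg, abs_mul]
    calc |y r - c| * |deriv f r| ≤ 1 * M' :=
          mul_le_mul hyc (hM' r) (abs_nonneg _) zero_le_one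
      _ = M' := one_mul M'
  have h1 := hc.abs_abs_adiabatic_sub_le hf h ha hc01 hM s hs
  have hM0 : 0 ≤ M := (abs_nonneg _).trans (hM 0)
  have h2 : M * (s - a) ≤ M * 2 :=
    mul_le_mul_of_nonneg_left (by linarith [hs.2]) hM0
  have h3 := hcmp s (ha.trans hs.1)
  have h4 := hcmp a ha
  rw [abs_le] at h1 h3 h4 ⊢
  constructor <;> linarith [h1.1, h1.2, h3.1, h3.2, h4.1, h4.2]

end Adiabatic

/-! ### Crossing times -/

variable (B) in
/-- The time of the `n`-th crossing from the left to the right. -/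
noncomputable def crossRight (n : ℕ) : ℝ := B.tStar₁ + n * 2

variable (B) in
/-- The time of the `n`-th crossing from the right to the left, which follows
`B.crossRight n`. -/
noncomputable def crossLeft (n : ℕ) : ℝ := B.tStar₂ + n * 2

theorem crossLeft_sub_crossRight (n : ℕ) : B.crossLeft n - B.crossRight n = 2 - 2 * B.lam := by
  unfold crossLeft crossRight tStar₁ tStar₂
  ring

theorem crossRight_succ_sub_crossLeft (n : ℕ) :
    B.crossRight (n + 1) - B.crossLeft n = 2 * B.lam := by
  unfold crossLeft crossRight tStar₁ tStar₂
  push_cast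
  ring

theorem crossRight_lt_crossLeft (n : ℕ) : B.crossRight n < B.crossLeft n := by
  linarith [B.crossLeft_sub_crossRight n, B.lam_lt_one]

theorem crossLeft_lt_crossRight_succ (n : ℕ) : B.crossLeft n < B.crossRight (n + 1) := by
  linarith [B.crossRight_succ_sub_crossLeft n, B.lam_pos]

theorem crossRight_mono {m n : ℕ} (h : m ≤ n) : B.crossRight m ≤ B.crossRight n := by
  have : (m : ℝ) ≤ n := by exact_mod_cast h
  unfold crossRight
  linarith

theorem exists_le_crossRight (t : ℝ) : ∃ N, t ≤ B.crossRight N := by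
  obtain ⟨N, hN⟩ := exists_nat_ge (t - B.tStar₁)
  refine ⟨N, ?_⟩
  have : (0 : ℝ) ≤ N := N.cast_nonneg
  unfold crossRight
  linarith

theorem exists_mem_Ico_crossRight {N : ℕ} {t : ℝ} (ht : B.crossRight N ≤ t) :
    ∃ n, N ≤ n ∧ t ∈ Ico (B.crossRight n) (B.crossRight (n + 1)) := by
  unfold crossRight at ht
  have hN : (N : ℝ) ≤ (t - B.tStar₁) / 2 := by linarith
  have h0 : 0 ≤ (t - B.tStar₁) / 2 := N.cast_nonneg.trans hN
  refine ⟨⌊(t - B.tStar₁) / 2⌋₊, Nat.le_floor hN, ?_, ?_⟩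
  · have := Nat.floor_le h0
    unfold crossRight
    linarith
  · have := Nat.lt_floor_add_one ((t - B.tStar₁) / 2)
    unfold crossRight
    push_cast
    linarith

theorem _root_.Function.Periodic.apply_crossRight {f : ℝ → ℝ} (hf : Function.Periodic f 2)
    (n : ℕ) : f (B.crossRight n) = f B.tStar₁ :=
  hf.nat_mul n B.tStar₁

theorem _root_.Function.Periodic.apply_crossLeft {f : ℝ → ℝ} (hf : Function.Periodic f 2)
    (n : ℕ) : f (B.crossLeft n) = f B.tStar₂ :=
  hf.nat_mul n B.tStar₂

theorem horizontalPos_eq_of_mem_Ico {t : ℝ} (n : ℤ) (h0 : 0 ≤ B.x₀ + t - 2 * n)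
    (h2 : B.x₀ + t - 2 * n < 2) : B.horizontalPos t = 1 - |1 - (B.x₀ + t - 2 * n)| := by
  have : Int.fract ((B.x₀ + t) / 2) = (B.x₀ + t) / 2 - n := by
    rw [Int.fract, sub_right_inj, Int.cast_inj, Int.floor_eq_iff]
    constructor <;> linarith
  rw [horizontalPos, this]
  ring_nf

theorem lam_lt_horizontalPos {n : ℕ} {t : ℝ} (ht : t ∈ Ioo (B.crossRight n) (B.crossLeft n)) :
    B.lam < B.horizontalPos t := by
  obtain ⟨h1, h2⟩ := ht
  unfold crossRight tStar₁ at h1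
  unfold crossLeft tStar₂ at h2
  have := B.lam_pos
  rw [horizontalPos_eq_of_mem_Ico (n : ℤ) (by push_cast; linarith) (by push_cast; linarith),
    lt_sub_comm, abs_lt]
  push_cast
  constructor <;> linarith

theorem horizontalPos_lt_lam {n : ℕ} {t : ℝ}
    (ht : t ∈ Ioo (B.crossLeft n) (B.crossRight (n + 1))) : B.horizontalPos t < B.lam := by
  obtain ⟨h1, h2⟩ := ht
  unfold crossLeft tStar₂ at h1
  unfold crossRight tStar₁ at h2
  push_cast at h2
  have := B.lam_lt_one
  rcases lt_or_ge (B.x₀ + t - 2 * n) 2 with h | h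
  · rw [horizontalPos_eq_of_mem_Ico (n : ℤ) (by push_cast; linarith) (by push_cast; linarith),
      sub_lt_comm, lt_abs]
    push_cast
    right
    linarith
  · rw [horizontalPos_eq_of_mem_Ico (n + 1 : ℤ) (by push_cast; linarith) (by push_cast; linarith),
      sub_lt_comm, lt_abs]
    push_cast
    left
    linarith

theorem horizontalPos_crossRight (n : ℕ) : B.horizontalPos (B.crossRight n) = B.lam := by
  have := B.lam_pos
  have := B.lam_lt_one
  have e : B.x₀ + B.crossRight n - 2 * ((n : ℤ) : ℝ) = B.lam := by
    unfold crossRight tStar₁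
    push_cast
    ring
  rw [horizontalPos_eq_of_mem_Ico (n : ℤ) (by linarith) (by linarith), e,
    abs_of_pos (by linarith)]
  ring

theorem horizontalPos_crossLeft (n : ℕ) : B.horizontalPos (B.crossLeft n) = B.lam := by
  have := B.lam_pos
  have := B.lam_lt_one
  have e : B.x₀ + B.crossLeft n - 2 * ((n : ℤ) : ℝ) = 2 - B.lam := by
    unfold crossLeft tStar₂
    push_cast
    ring
  rw [horizontalPos_eq_of_mem_Ico (n : ℤ) (by linarith) (by linarith), e,
    abs_of_neg (by linarith)]
  ring

/-! ### Passages along one slit -/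

/-- During a passage along one slit the ball stays on one side of it. -/
theorem IsForwardOrbit.forall_le_or_forall_ge {t₀ : ℝ} {y v : ℝ → ℝ}
    (h : B.IsForwardOrbit t₀ y v) {f : ℝ → ℝ} (hf : Continuous f) {a b : ℝ} (ha : t₀ ≤ a)
    (hab : a < b) (hne : ∀ s ∈ Ioo a b, B.horizontalPos s ≠ B.lam)
    (hs : ∀ s ∈ Ioo a b, B.slitHeight s = f s) :
    (∀ s ∈ Icc a b, y s ≤ f s) ∨ ∀ s ∈ Icc a b, f s ≤ y s := by
  have hyc : ContinuousOn y (Icc a b) := h.continuousOn.mono fun s hs => ha.trans hs.1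
  have hside : (∀ s ∈ Ioo a b, y s ≤ f s) ∨ ∀ s ∈ Ioo a b, f s ≤ y s := by
    by_contra! hcon
    obtain ⟨⟨r, hr, hr'⟩, ⟨s, hs1, hs'⟩⟩ := hcon
    have hsub : Icc (min r s) (max r s) ⊆ Ioo a b := fun x hx =>
      ⟨(lt_min hr.1 hs1.1).trans_le hx.1, hx.2.trans_lt (max_lt hr.2 hs1.2)⟩
    have hrm : r ∈ Icc (min r s) (max r s) := ⟨min_le_left _ _, le_max_left _ _⟩
    have hsm : s ∈ Icc (min r s) (max r s) := ⟨min_le_right _ _, le_max_right _ _⟩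
    rcases h.one_side (min r s) (max r s) (le_min (ha.trans hr.1.le) (ha.trans hs1.1.le))
      (min_le_max) (fun x hx => hne x (hsub hx)) with h1 | h1
    · have := h1 r hrm
      rw [hs r hr] at this
      exact hr'.not_ge this
    · have := h1 s hsm
      rw [hs s hs1] at this
      exact hs'.not_ge this
  rw [← closure_Ioo hab.ne] at hyc ⊢
  exact hside.imp (fun H s hs => le_on_closure H hyc hf.continuousOn hs)
    (fun H s hs => le_on_closure H hf.continuousOn hyc hs)

/-- A ball that stays below `f` collides only with the floor and the slit, and one that stays above
`f` only with the ceiling and the slit. -/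
theorem IsForwardOrbit.confined {t₀ : ℝ} {y v : ℝ → ℝ}
    (h : B.IsForwardOrbit t₀ y v) {f : ℝ → ℝ} (hf01 : ∀ t, f t ∈ Ioo (0 : ℝ) 1) {a b c : ℝ}
    (ha : t₀ ≤ a) (hs : ∀ s ∈ Ioo a b, B.slitHeight s = f s)
    (hs' : ∀ s ∈ Ioo a b, B.slitVelocity s = deriv f s) (hb : B.horizontalPos b = B.lam)
    (hc : (c = 0 ∧ ∀ s ∈ Icc a b, y s ≤ f s) ∨ (c = 1 ∧ ∀ s ∈ Icc a b, f s ≤ y s)) :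
    B.Confined f c y a b := by
  intro t ht hcon
  have hI : t ∈ Icc a b := ⟨ht.1.le, ht.2⟩
  rcases hcon with h0 | h1 | hsl
  · rcases hc with ⟨rfl, -⟩ | ⟨-, hc⟩
    · exact Or.inl ⟨Or.inl h0, h0⟩
    · exact absurd (hc t hI) (by rw [h0]; exact (hf01 t).1.not_ge)
  · rcases hc with ⟨-, hc⟩ | ⟨rfl, -⟩
    · exact absurd (hc t hI) (by rw [h1]; exact (hf01 t).2.not_ge)
    · exact Or.inl ⟨Or.inr h1, h1⟩
  · rcases ht.2.eq_or_lt with rfl | hlt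
    · have := (h.avoids_tips t (ha.trans hI.1) hb).2
      rw [slitHeight, if_neg (by rw [hb]; exact lt_irrefl _)] at hsl
      exact absurd hsl this
    · exact Or.inr ⟨hsl, hs t ⟨ht.1, hlt⟩, hs' t ⟨ht.1, hlt⟩⟩

theorem slitHeight_right {n : ℕ} {t : ℝ} (ht : t ∈ Ioo (B.crossRight n) (B.crossLeft n)) :
    B.slitHeight t = B.fR t :=
  if_neg (lam_lt_horizontalPos ht).not_gt

theorem slitVelocity_right {n : ℕ} {t : ℝ} (ht : t ∈ Ioo (B.crossRight n) (B.crossLeft n)) :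
    B.slitVelocity t = deriv B.fR t :=
  if_neg (lam_lt_horizontalPos ht).not_gt

theorem slitHeight_left {n : ℕ} {t : ℝ} (ht : t ∈ Ioo (B.crossLeft n) (B.crossRight (n + 1))) :
    B.slitHeight t = B.fL t :=
  if_pos (horizontalPos_lt_lam ht)

theorem slitVelocity_left {n : ℕ} {t : ℝ} (ht : t ∈ Ioo (B.crossLeft n) (B.crossRight (n + 1))) :
    B.slitVelocity t = deriv B.fL t :=
  if_pos (horizontalPos_lt_lam ht)

/-! ### Bounds for periodic functions -/

theorem _root_.Function.Periodic.exists_abs_le {f : ℝ → ℝ} (hf : Function.Periodic f 2)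
    (hc : Continuous f) : ∃ M, ∀ t, |f t| ≤ M := by
  obtain ⟨M, hM⟩ := (hf.isBounded_of_continuous two_ne_zero hc).exists_norm_le
  exact ⟨M, fun t => hM _ (mem_range_self t)⟩

theorem _root_.Function.Periodic.exists_pos_le_abs {f : ℝ → ℝ} (hf : Function.Periodic f 2)
    (hc : Continuous f) (h0 : ∀ t, f t ≠ 0) : ∃ δ > 0, ∀ t, δ ≤ |f t| := by
  have hp : Function.Periodic (fun t => (f t)⁻¹) 2 := fun t => by simp only [hf t]
  obtain ⟨M, hM⟩ := hp.exists_abs_le (hc.inv₀ h0)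
  have hM0 : 0 < M := (abs_pos.2 (inv_ne_zero (h0 0))).trans_le (hM 0)
  refine ⟨M⁻¹, inv_pos.2 hM0, fun t => inv_le_of_inv_le₀ (abs_pos.2 (h0 t)) ?_⟩
  rw [← abs_inv]
  exact hM t

theorem _root_.Function.Periodic.deriv_two {f : ℝ → ℝ} (hf : Function.Periodic f 2) :
    Function.Periodic (deriv f) 2 := fun t => by
  rw [← deriv_comp_add_const]
  congr 1
  exact funext hf

/-! ### Recursive inequalities for the speed -/

theorem exists_le_of_le_mul_add {u : ℕ → ℝ} {N : ℕ} {ρ C : ℝ} (hρ0 : 0 ≤ ρ) (hρ : ρ < 1)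
    (hu : ∀ n ≥ N, u (n + 1) ≤ ρ * u n + C) : ∃ D, ∀ n ≥ N, u n ≤ D := by
  refine ⟨max (u N) (C / (1 - ρ)), fun n hn => ?_⟩
  induction n, hn using Nat.le_induction with
  | base => exact le_max_left _ _
  | succ n hn ih =>
    have h1 : C ≤ (1 - ρ) * max (u N) (C / (1 - ρ)) := by
      rw [mul_comm, ← div_le_iff₀ (by linarith)]
      exact le_max_right _ _
    have h2 := mul_le_mul_of_nonneg_left ih hρ0
    linarith [hu n hn]

/-- An expanding recursive inequality forces boundedness or divergence: once above the fixed point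
`C / (ρ - 1)`, the distance to it grows geometrically. -/
theorem exists_le_or_tendsto_of_mul_sub_le {u : ℕ → ℝ} {N : ℕ} {ρ C : ℝ} (hρ : 1 < ρ)
    (hu : ∀ n ≥ N, ρ * u n - C ≤ u (n + 1)) :
    (∃ D, ∀ n ≥ N, u n ≤ D) ∨ Tendsto u atTop atTop := by
  by_cases hb : ∃ D, ∀ n ≥ N, u n ≤ D
  · exact Or.inl hb
  right
  push Not at hb
  obtain ⟨n, hn, hDn⟩ := hb (C / (ρ - 1))
  set D := C / (ρ - 1)
  have hD : ρ * D - C = D := by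
    have : D * (ρ - 1) = C := div_mul_cancel₀ _ (by linarith)
    linarith
  have hgrow : ∀ k, ρ ^ k * (u n - D) + D ≤ u (n + k) := by
    intro k
    induction k with
    | zero => simp
    | succ k ih =>
      have h1 := mul_le_mul_of_nonneg_left ih (by linarith : (0 : ℝ) ≤ ρ)
      have h2 := hu (n + k) (by omega)
      rw [← add_assoc, pow_succ]
      linarith
  have hlim : Tendsto (fun k => ρ ^ k * (u n - D) + D) atTop atTop :=
    tendsto_atTop_add_const_right _ _
      ((tendsto_pow_atTop_atTop_of_one_lt hρ).atTop_mul_const (by linarith))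
  rw [← tendsto_add_atTop_iff_nat n]
  refine tendsto_atTop_mono (fun k => ?_) hlim
  rw [add_comm k n]
  exact hgrow k

/-! ### The speed in a chamber -/

/-- A ball that remains between the wall `c` and the slits has bounded speed or its speed tends to
infinity, provided that at both crossings the chamber gets wider, or at both it gets narrower. By
adiabatic invariance the speed is multiplied over one period, up to a bounded error, by
`(|fR - c| / |fL - c|) (tStar₁) * (|fL - c| / |fR - c|) (tStar₂)`. -/
theorem IsForwardOrbit.bounded_or_tendsto_of_confined {t₀ : ℝ} {y v : ℝ → ℝ}
    (h : B.IsForwardOrbit t₀ y v) {c : ℝ} (hc01 : c = 0 ∨ c = 1) {N : ℕ}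
    (hN : t₀ ≤ B.crossRight N)
    (hR : ∀ n ≥ N, B.Confined B.fR c y (B.crossRight n) (B.crossLeft n))
    (hL : ∀ n ≥ N, B.Confined B.fL c y (B.crossLeft n) (B.crossRight (n + 1)))
    (hgain : (|B.fL B.tStar₁ - c| < |B.fR B.tStar₁ - c| ∧
        |B.fR B.tStar₂ - c| < |B.fL B.tStar₂ - c|) ∨
      (|B.fR B.tStar₁ - c| < |B.fL B.tStar₁ - c| ∧
        |B.fL B.tStar₂ - c| < |B.fR B.tStar₂ - c|)) :
    (∃ D, ∀ᶠ t in atTop, |v t| ≤ D) ∨ Tendsto (fun t => |v t|) atTop atTop := by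
  have hne : ∀ {x : ℝ}, x ∈ Ioo (0 : ℝ) 1 → x - c ≠ 0 := by
    rintro x ⟨h0, h1⟩
    rcases hc01 with rfl | rfl
    · simpa using h0.ne'
    · linarith
  have hle : ∀ {x : ℝ}, x ∈ Ioo (0 : ℝ) 1 → |x - c| ≤ 1 := by
    rintro x ⟨h0, h1⟩
    rw [abs_le]
    rcases hc01 with rfl | rfl <;> constructor <;> linarith
  -- adiabatic invariance with uniform constants
  have inv : ∀ {f : ℝ → ℝ}, ContDiff ℝ 2 f → Function.Periodic f 2 → ∃ K, ∀ a b, t₀ ≤ a →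
      b - a ≤ 2 → B.Confined f c y a b →
      ∀ s ∈ Icc a b, |(|v s| * |f s - c| - |v a| * |f a - c|)| ≤ K := by
    intro f hf hp
    have hf' : ContDiff ℝ 1 (deriv f) := (contDiff_succ_iff_deriv (n := 1).1 hf).2.2
    obtain ⟨M', hM'⟩ := hp.deriv_two.exists_abs_le hf'.continuous
    obtain ⟨M, hM⟩ := hp.deriv_two.deriv_two.exists_abs_le (hf'.continuous_deriv le_rfl)
    exact ⟨_, fun a b ha hba hcf => hcf.abs_mul_sub_le hf h ha hc01 hba hM hM'⟩
  obtain ⟨KR, hKR⟩ := inv B.fR_contDiff B.fR_periodic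
  obtain ⟨KL, hKL⟩ := inv B.fL_contDiff B.fL_periodic
  have low : ∀ {f : ℝ → ℝ}, ContDiff ℝ 2 f → Function.Periodic f 2 →
      (∀ t, f t ∈ Ioo (0 : ℝ) 1) → ∃ δ > 0, ∀ t, δ ≤ |f t - c| := by
    intro f hf hp hm
    exact Function.Periodic.exists_pos_le_abs (f := fun t => f t - c)
      (fun t => by simp only [hp t]) (hf.continuous.sub continuous_const) fun t => hne (hm t)
  obtain ⟨δR, hδR, hδR'⟩ := low B.fR_contDiff B.fR_periodic B.fR_mem
  obtain ⟨δL, hδL, hδL'⟩ := low B.fL_contDiff B.fL_periodic B.fL_mem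
  set p := |B.fR B.tStar₁ - c| with hp
  set q := |B.fR B.tStar₂ - c| with hq
  set r := |B.fL B.tStar₂ - c| with hr
  set w := |B.fL B.tStar₁ - c| with hw
  have hp0 : 0 < p := abs_pos.2 (hne (B.fR_mem _))
  have hq0 : 0 < q := abs_pos.2 (hne (B.fR_mem _))
  have hr0 : 0 < r := abs_pos.2 (hne (B.fL_mem _))
  have hw0 : 0 < w := abs_pos.2 (hne (B.fL_mem _))
  have hr1 : r ≤ 1 := hle (B.fL_mem _)
  have ht0 : ∀ n ≥ N, t₀ ≤ B.crossRight n := fun n hn => hN.trans (crossRight_mono hn)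
  set u : ℕ → ℝ := fun n => |v (B.crossRight n)| with hu
  -- invariance during the two passages of the `n`-th period
  have stepR : ∀ n ≥ N, ∀ s ∈ Icc (B.crossRight n) (B.crossLeft n),
      |(|v s| * |B.fR s - c| - u n * p)| ≤ KR := by
    intro n hn s hs
    have := hKR _ _ (ht0 n hn)
      (by linarith [B.crossLeft_sub_crossRight n, B.lam_pos]) (hR n hn) s hs
    rwa [B.fR_periodic.apply_crossRight] at this
  have stepL : ∀ n ≥ N, ∀ s ∈ Icc (B.crossLeft n) (B.crossRight (n + 1)),
      |(|v s| * |B.fL s - c| - |v (B.crossLeft n)| * r)| ≤ KL := by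
    intro n hn s hs
    have := hKL _ _ ((ht0 n hn).trans (crossRight_lt_crossLeft n).le)
      (by linarith [B.crossRight_succ_sub_crossLeft n, B.lam_lt_one]) (hL n hn) s hs
    rwa [B.fL_periodic.apply_crossLeft] at this
  have midR : ∀ n ≥ N, |(|v (B.crossLeft n)| * q - u n * p)| ≤ KR := by
    intro n hn
    have := stepR n hn _ (right_mem_Icc.2 (crossRight_lt_crossLeft n).le)
    rwa [B.fR_periodic.apply_crossLeft] at this
  have hKR0 : 0 ≤ KR := (abs_nonneg _).trans (midR N le_rfl)
  -- the same with the outgoing velocity of the first passage eliminated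
  have stepL' : ∀ n ≥ N, ∀ s ∈ Icc (B.crossLeft n) (B.crossRight (n + 1)),
      |(|v s| * |B.fL s - c| - u n * (p * r / q))| ≤ KL + KR * (r / q) := by
    intro n hn s hs
    have h1 := stepL n hn s hs
    have h2 : |(|v (B.crossLeft n)| * r - u n * (p * r / q))| ≤ KR * (r / q) := by
      have e : |v (B.crossLeft n)| * r - u n * (p * r / q) =
          (|v (B.crossLeft n)| * q - u n * p) * (r / q) := by
        field_simp
      rw [e, abs_mul, abs_of_pos (div_pos hr0 hq0)]
      exact mul_le_mul_of_nonneg_right (midR n hn) (div_pos hr0 hq0).le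
    exact (abs_sub_le _ _ _).trans (add_le_add h1 h2)
  set ρ := p * r / (q * w) with hρ
  set K := KL + KR * (r / q) with hK
  have step : ∀ n ≥ N, |u (n + 1) - ρ * u n| ≤ K / w := by
    intro n hn
    have h1 := stepL' n hn _ (right_mem_Icc.2 (crossLeft_lt_crossRight_succ n).le)
    rw [B.fL_periodic.apply_crossRight] at h1
    have e : u (n + 1) - ρ * u n = (u (n + 1) * w - u n * (p * r / q)) / w := by
      rw [hρ]
      field_simp
    rw [e, abs_div, abs_of_pos hw0]
    exact div_le_div_of_nonneg_right h1 hw0.le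
  have hdich : (∃ D, ∀ n ≥ N, u n ≤ D) ∨ Tendsto u atTop atTop := by
    rcases hgain with ⟨h1, h2⟩ | ⟨h1, h2⟩
    · refine exists_le_or_tendsto_of_mul_sub_le (ρ := ρ) (C := K / w) (N := N) ?_ fun n hn => ?_
      · rw [hρ, one_lt_div (by positivity), mul_comm p r]
        exact mul_lt_mul'' h2 h1 hq0.le hw0.le
      · linarith [(abs_le.1 (step n hn)).1]
    · refine Or.inl (exists_le_of_le_mul_add (ρ := ρ) (C := K / w) (by positivity) ?_
        fun n hn => ?_)
      · rw [hρ, div_lt_one (by positivity), mul_comm p r]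
        exact mul_lt_mul'' h2 h1 hr0.le hp0.le
      · linarith [(abs_le.1 (step n hn)).2]
  have hpq : 0 < p * r / q := by positivity
  rcases hdich with ⟨D, hD⟩ | hlim
  · left
    refine ⟨max ((D * p + KR) / δR) ((D * (p * r / q) + K) / δL), ?_⟩
    filter_upwards [eventually_ge_atTop (B.crossRight N)] with t ht
    obtain ⟨n, hn, htn⟩ := exists_mem_Ico_crossRight ht
    rcases le_total t (B.crossLeft n) with hside | hside
    · refine le_max_of_le_left ((le_div_iff₀ hδR).2 ?_)
      have h1 := (abs_le.1 (stepR n hn t ⟨htn.1, hside⟩)).2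
      have h2 := mul_le_mul_of_nonneg_left (hδR' t) (abs_nonneg (v t))
      have h3 := mul_le_mul_of_nonneg_right (hD n hn) hp0.le
      linarith
    · refine le_max_of_le_right ((le_div_iff₀ hδL).2 ?_)
      have h1 := (abs_le.1 (stepL' n hn t ⟨hside, htn.2.le⟩)).2
      have h2 := mul_le_mul_of_nonneg_left (hδL' t) (abs_nonneg (v t))
      have h3 := mul_le_mul_of_nonneg_right (hD n hn) hpq.le
      linarith
  · right
    refine tendsto_atTop.2 fun A => ?_
    obtain ⟨N', hN'⟩ := eventually_atTop.1 (hlim.eventually_ge_atTop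
      (max ((|A| + KR) / p) ((|A| + K) / (p * r / q))))
    filter_upwards [eventually_ge_atTop (B.crossRight (max N N'))] with t ht
    obtain ⟨n, hn, htn⟩ := exists_mem_Ico_crossRight ht
    have hnN : N ≤ n := (le_max_left _ _).trans hn
    have hun := hN' n ((le_max_right _ _).trans hn)
    refine (le_abs_self A).trans ?_
    rcases le_total t (B.crossLeft n) with hside | hside
    · have h1 := (abs_le.1 (stepR n hnN t ⟨htn.1, hside⟩)).1
      have h2 := mul_le_mul_of_nonneg_left (hle (B.fR_mem t)) (abs_nonneg (v t))
      have h3 := (div_le_iff₀ hp0).1 ((le_max_left _ _).trans hun)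
      linarith
    · have h1 := (abs_le.1 (stepL' n hnN t ⟨hside, htn.2.le⟩)).1
      have h2 := mul_le_mul_of_nonneg_left (hle (B.fL_mem t)) (abs_nonneg (v t))
      have h3 := (div_le_iff₀ hpq).1 ((le_max_right _ _).trans hun)
      linarith

/-! ### Capture by the trapping chamber -/

/-- If a passage on the side `P` is always followed by a passage on the side `P`, then one of the
two sides is eventually the only one. Here `PR n`, `PL n` (resp. `QR n`, `QL n`) say that the ball
is on the side `P` (resp. on the other side) during the `n`-th passage on the right and on the
left. -/
theorem eventually_side {PR PL QR QL : ℕ → Prop} (N : ℕ) (hR : ∀ n ≥ N, PR n ∨ QR n)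
    (hL : ∀ n ≥ N, PL n ∨ QL n) (hRL : ∀ n ≥ N, PR n → PL n)
    (hLR : ∀ n ≥ N, PL n → PR (n + 1)) :
    ∃ N' ≥ N, (∀ n ≥ N', PR n ∧ PL n) ∨ ∀ n ≥ N', QR n ∧ QL n := by
  by_cases hex : ∃ n ≥ N, PR n
  · obtain ⟨N', hN', hP⟩ := hex
    have hall : ∀ n ≥ N', PR n := by
      intro n hn
      induction n, hn using Nat.le_induction with
      | base => exact hP
      | succ n hn ih => exact hLR n (hN'.trans hn) (hRL n (hN'.trans hn) ih)
    exact ⟨N', hN', Or.inl fun n hn => ⟨hall n hn, hRL n (hN'.trans hn) (hall n hn)⟩⟩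
  · push Not at hex
    exact ⟨N, le_rfl, Or.inr fun n hn => ⟨(hR n hn).resolve_left (hex n hn),
      (hL n hn).resolve_left fun hP => hex (n + 1) (by omega) (hLR n hn hP)⟩⟩

theorem IsForwardOrbit.bounded_or_tendsto {t₀ : ℝ} {y v : ℝ → ℝ}
    (h : B.IsForwardOrbit t₀ y v) (hB : B.HasTrappingChamber) :
    (∃ D, ∀ᶠ t in atTop, |v t| ≤ D) ∨ Tendsto (fun t => |v t|) atTop atTop := by
  obtain ⟨N, hN⟩ := B.exists_le_crossRight t₀
  have ht0 : ∀ n ≥ N, t₀ ≤ B.crossRight n := fun n hn => hN.trans (crossRight_mono hn)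
  have ht0' : ∀ n ≥ N, t₀ ≤ B.crossLeft n := fun n hn =>
    (ht0 n hn).trans (crossRight_lt_crossLeft n).le
  have sideR : ∀ n ≥ N, (∀ s ∈ Icc (B.crossRight n) (B.crossLeft n), y s ≤ B.fR s) ∨
      ∀ s ∈ Icc (B.crossRight n) (B.crossLeft n), B.fR s ≤ y s := fun n hn =>
    h.forall_le_or_forall_ge B.fR_contDiff.continuous (ht0 n hn) (crossRight_lt_crossLeft n)
      (fun s hs => (lam_lt_horizontalPos hs).ne') fun s hs => slitHeight_right hs
  have sideL : ∀ n ≥ N, (∀ s ∈ Icc (B.crossLeft n) (B.crossRight (n + 1)), y s ≤ B.fL s) ∨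
      ∀ s ∈ Icc (B.crossLeft n) (B.crossRight (n + 1)), B.fL s ≤ y s := fun n hn =>
    h.forall_le_or_forall_ge B.fL_contDiff.continuous (ht0' n hn)
      (crossLeft_lt_crossRight_succ n)
      (fun s hs => (horizontalPos_lt_lam hs).ne) fun s hs => slitHeight_left hs
  have confR : ∀ {c : ℝ}, ∀ n ≥ N,
      ((c = 0 ∧ ∀ s ∈ Icc (B.crossRight n) (B.crossLeft n), y s ≤ B.fR s) ∨
        (c = 1 ∧ ∀ s ∈ Icc (B.crossRight n) (B.crossLeft n), B.fR s ≤ y s)) →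
      B.Confined B.fR c y (B.crossRight n) (B.crossLeft n) := fun n hn =>
    h.confined B.fR_mem (ht0 n hn) (fun s hs => slitHeight_right hs)
      (fun s hs => slitVelocity_right hs) (horizontalPos_crossLeft n)
  have confL : ∀ {c : ℝ}, ∀ n ≥ N,
      ((c = 0 ∧ ∀ s ∈ Icc (B.crossLeft n) (B.crossRight (n + 1)), y s ≤ B.fL s) ∨
        (c = 1 ∧ ∀ s ∈ Icc (B.crossLeft n) (B.crossRight (n + 1)), B.fL s ≤ y s)) →
      B.Confined B.fL c y (B.crossLeft n) (B.crossRight (n + 1)) := fun n hn =>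
    h.confined B.fL_mem (ht0' n hn) (fun s hs => slitHeight_left hs)
      (fun s hs => slitVelocity_left hs) (horizontalPos_crossRight (n + 1))
  -- in either trapping case each chamber gets wider at both crossings or narrower at both
  have gain : ∀ {c : ℝ}, c = 0 ∨ c = 1 → (|B.fL B.tStar₁ - c| < |B.fR B.tStar₁ - c| ∧
        |B.fR B.tStar₂ - c| < |B.fL B.tStar₂ - c|) ∨
      (|B.fR B.tStar₁ - c| < |B.fL B.tStar₁ - c| ∧
        |B.fL B.tStar₂ - c| < |B.fR B.tStar₂ - c|) := by
    have habs0 : ∀ {x : ℝ}, x ∈ Ioo (0 : ℝ) 1 → |x - 0| = x := fun hx => by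
      rw [sub_zero, abs_of_pos hx.1]
    have habs1 : ∀ {x : ℝ}, x ∈ Ioo (0 : ℝ) 1 → |x - 1| = 1 - x := fun hx => by
      rw [abs_of_neg (by linarith [hx.2]), neg_sub]
    rintro c (rfl | rfl)
    · simp only [habs0 (B.fL_mem _), habs0 (B.fR_mem _)]
      exact hB
    · simp only [habs1 (B.fL_mem _), habs1 (B.fR_mem _), sub_lt_sub_iff_left]
      exact hB.symm
  have finish : ∀ {c : ℝ}, c = 0 ∨ c = 1 → ∀ N' ≥ N,
      (∀ n ≥ N', B.Confined B.fR c y (B.crossRight n) (B.crossLeft n)) →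
      (∀ n ≥ N', B.Confined B.fL c y (B.crossLeft n) (B.crossRight (n + 1))) →
      (∃ D, ∀ᶠ t in atTop, |v t| ≤ D) ∨ Tendsto (fun t => |v t|) atTop atTop :=
    fun hc N' hN' hR hL => h.bounded_or_tendsto_of_confined hc (ht0 N' hN') hR hL (gain hc)
  have lower : ∀ N' ≥ N, (∀ n ≥ N',
      (∀ s ∈ Icc (B.crossRight n) (B.crossLeft n), y s ≤ B.fR s) ∧
      ∀ s ∈ Icc (B.crossLeft n) (B.crossRight (n + 1)), y s ≤ B.fL s) →
      (∃ D, ∀ᶠ t in atTop, |v t| ≤ D) ∨ Tendsto (fun t => |v t|) atTop atTop :=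
    fun N' hN' H => finish (Or.inl rfl) N' hN'
      (fun n hn => confR n (hN'.trans hn) (Or.inl ⟨rfl, (H n hn).1⟩))
      (fun n hn => confL n (hN'.trans hn) (Or.inl ⟨rfl, (H n hn).2⟩))
  have upper : ∀ N' ≥ N, (∀ n ≥ N',
      (∀ s ∈ Icc (B.crossRight n) (B.crossLeft n), B.fR s ≤ y s) ∧
      ∀ s ∈ Icc (B.crossLeft n) (B.crossRight (n + 1)), B.fL s ≤ y s) →
      (∃ D, ∀ᶠ t in atTop, |v t| ≤ D) ∨ Tendsto (fun t => |v t|) atTop atTop :=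
    fun N' hN' H => finish (Or.inr rfl) N' hN'
      (fun n hn => confR n (hN'.trans hn) (Or.inr ⟨rfl, (H n hn).1⟩))
      (fun n hn => confL n (hN'.trans hn) (Or.inr ⟨rfl, (H n hn).2⟩))
  have memR : ∀ n, B.crossLeft n ∈ Icc (B.crossRight n) (B.crossLeft n) := fun n =>
    right_mem_Icc.2 (crossRight_lt_crossLeft n).le
  have memR' : ∀ n, B.crossRight n ∈ Icc (B.crossRight n) (B.crossLeft n) := fun n =>
    left_mem_Icc.2 (crossRight_lt_crossLeft n).le
  have memL : ∀ n, B.crossLeft n ∈ Icc (B.crossLeft n) (B.crossRight (n + 1)) := fun n =>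
    left_mem_Icc.2 (crossLeft_lt_crossRight_succ n).le
  have memL' : ∀ n, B.crossRight (n + 1) ∈ Icc (B.crossLeft n) (B.crossRight (n + 1)) := fun n =>
    right_mem_Icc.2 (crossLeft_lt_crossRight_succ n).le
  have eL₁ := fun n => B.fL_periodic.apply_crossRight (B := B) n
  have eR₁ := fun n => B.fR_periodic.apply_crossRight (B := B) n
  have eL₂ := fun n => B.fL_periodic.apply_crossLeft (B := B) n
  have eR₂ := fun n => B.fR_periodic.apply_crossLeft (B := B) n
  rcases hB with ⟨h1, h2⟩ | ⟨h1, h2⟩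
  · obtain ⟨N', hN', H | H⟩ := eventually_side N sideR sideL
      (fun n hn hP => (sideL n hn).resolve_right fun hQ => by
        linarith [hP _ (memR n), hQ _ (memL n), eL₂ n, eR₂ n])
      (fun n hn hP => (sideR (n + 1) (by omega)).resolve_right fun hQ => by
        linarith [hP _ (memL' n), hQ _ (memR' (n + 1)), eL₁ (n + 1), eR₁ (n + 1)])
    · exact lower N' hN' H
    · exact upper N' hN' H
  · obtain ⟨N', hN', H | H⟩ := eventually_side N (fun n hn => (sideR n hn).symm)
      (fun n hn => (sideL n hn).symm)
      (fun n hn hP => (sideL n hn).resolve_left fun hQ => by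
        linarith [hP _ (memR n), hQ _ (memL n), eL₂ n, eR₂ n])
      (fun n hn hP => (sideR (n + 1) (by omega)).resolve_left fun hQ => by
        linarith [hP _ (memL' n), hQ _ (memR' (n + 1)), eL₁ (n + 1), eR₁ (n + 1)])
    · exact upper N' hN' H
    · exact lower N' hN' H

end SlitBilliard

theorem mainTheorem3 (B : SlitBilliard) (hB : B.HasTrappingChamber) :
    ¬ ∃ (t₀ : ℝ) (y v : ℝ → ℝ), B.IsForwardOrbit t₀ y v ∧ IsOscillatory v := by
  rintro ⟨t₀, y, v, h, hsup, hinf⟩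
  rcases h.bounded_or_tendsto hB with ⟨D, hD⟩ | hlim
  · have hle : limsup (fun t => ((|v t| : ℝ) : EReal)) atTop ≤ (D : EReal) := by
      refine limsup_le_of_le (by isBoundedDefault) ?_
      filter_upwards [hD] with t ht using EReal.coe_le_coe_iff.2 ht
    rw [hsup] at hle
    exact (EReal.coe_lt_top D).not_ge hle
  · have : Tendsto (fun t => ((|v t| : ℝ) : EReal)) atTop (𝓝 ⊤) :=
      EReal.tendsto_coe_nhds_top_iff.2 hlim
    rw [this.liminf_eq] at hinf
    exact lt_irrefl _ hinf
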